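/- Let $T$ be an equilateral triangle with side $1$, let $O$ be its centroid, $h=\sqrt3/2$ its height and $y=h/3$. Let $0\le r\le 1$. Two agents start at $O$ at time $0$ and move in the plane with speed at most $1$. An exit is located at an unknown point of the perimeter of $T$. An agent finds the exit only when it is at the exit, and the two agents can exchange information exactly when their distance is at most $r$. An evacuation algorithm assigns to each agent in advance a trajectory that does not depend on the exit; an agent may leave its trajectory only after it has found the exit, or after it has been notified of the location of the exit by the other agent (that is, after it has been at distance at most $r$ from the other agent at a moment when that agent had already found the exit), and from then on it may move in any way, depending on the location of the exit. The evacuation time of an algorithm is the supremum, over all locations of the exit on the perimeter, of the time by which both agents have reached the exit ($+\infty$ if this never happens). Then every evacuation algorithm has evacuation time at least $\max\{1.5+y,\;1+4y-r\}$; that is, the optimal evacuation time satisfies $E^*(2,r)\ge\max\{1.5+y,\;1+4y-r\}$, where $E^*(2,r)$ is the infimum of the evacuation times of all evacuation algorithms for two agents with range $r$. -/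

import Mathlib

open scoped NNReal ENNReal

noncomputable section

namespace TriangleEvacuation

/-- The Euclidean plane. -/
abbrev Plane : Type := EuclideanSpace ℝ (Fin 2)

/-- The top vertex of the equilateral triangle with side 1. -/
def vertexA : Plane := !₂[1 / 2, √3 / 2]

/-- The bottom left vertex. -/
def vertexB : Plane := !₂[0, 0]

/-- The bottom right vertex. -/
def vertexC : Plane := !₂[1, 0]

/-- The three sides have length 1. -/
theorem side_lengths :
    dist vertexA vertexB = 1 ∧ dist vertexB vertexC = 1 ∧ dist vertexC vertexA = 1 := by
  have h3 : √3 ^ 2 = 3 := Real.sq_sqrt (by norm_num)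
  refine ⟨?_, ?_, ?_⟩ <;>
    simp [vertexA, vertexB, vertexC, EuclideanSpace.dist_eq, Real.dist_eq, Fin.sum_univ_two,
      sq_abs, div_pow, h3] <;> norm_num

/-- The perimeter of the triangle: the set of possible locations of the exit. -/
def perimeter : Set Plane :=
  segment ℝ vertexA vertexB ∪ segment ℝ vertexB vertexC ∪ segment ℝ vertexC vertexA

/-- The centroid of the triangle, where the agents start. -/
def centroid : Plane := (3⁻¹ : ℝ) • (vertexA + vertexB + vertexC)

/-- The height `h` of the triangle. -/
def height : ℝ := dist vertexA (midpoint ℝ vertexB vertexC)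

/-- `y = h / 3`. -/
def y : ℝ := height / 3

/-- A legal motion of one agent: it starts at the centroid and its speed never exceeds 1. -/
def IsMotion (p : ℝ≥0 → Plane) : Prop :=
  p 0 = centroid ∧ LipschitzWith 1 p

/-- An agent moving along `p` has reached the point `x` at time `t` or before. -/
def HasReached (p : ℝ≥0 → Plane) (x : Plane) (t : ℝ≥0) : Prop :=
  ∃ s ≤ t, p s = x

/-- For agents moving along `m 0` and `m 1` with transmission range `r`, when the exit is at `x`:
by time `t`, agent `i` has found the exit, or has been at distance at most `r` from the other agent
at a moment when that one had already found the exit. -/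
def KnowsExit (r : ℝ) (m : Fin 2 → ℝ≥0 → Plane) (x : Plane) (i : Fin 2) (t : ℝ≥0) : Prop :=
  HasReached (m i) x t ∨
    ∃ s ≤ t, ∃ j, j ≠ i ∧ dist (m i s) (m j s) ≤ r ∧ HasReached (m j) x s

/-- An evacuation algorithm for two agents with transmission range `r`.

Each agent is assigned in advance a trajectory that does not depend on the exit; `motion x` is how
the agents actually move when the exit is at `x`. An agent may leave its trajectory only once it has
found the exit or has been notified of its location by the other agent. From then on it knows `x`,
and its motion may depend on `x` in any way. -/
structure Algorithm (r : ℝ) where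
  /-- the trajectories assigned before the search begins -/
  trajectory : Fin 2 → ℝ≥0 → Plane
  /-- the actual motions, for every location of the exit -/
  motion : Plane → Fin 2 → ℝ≥0 → Plane
  isMotion_trajectory : ∀ i, IsMotion (trajectory i)
  isMotion_motion : ∀ x ∈ perimeter, ∀ i, IsMotion (motion x i)
  follows_trajectory : ∀ x ∈ perimeter, ∀ i t,
    ¬ KnowsExit r (motion x) x i t → motion x i t = trajectory i t

variable {r : ℝ}

/-- The time by which both agents have reached the exit located at `x`
(`⊤` if this never happens). -/
def Algorithm.evacuationTimeAt (𝒜 : Algorithm r) (x : Plane) : ℝ≥0∞ :=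
  ⨅ (T : ℝ≥0) (_ : ∀ i, HasReached (𝒜.motion x i) x T), (T : ℝ≥0∞)

/-- The worst-case evacuation time of an algorithm, over all locations of the exit. -/
def Algorithm.evacuationTime (𝒜 : Algorithm r) : ℝ≥0∞ :=
  ⨆ x ∈ perimeter, 𝒜.evacuationTimeAt x

/-- The optimal evacuation time of two agents with transmission range `r`. -/
def optimalEvacuationTime (r : ℝ) : ℝ≥0∞ :=
  ⨅ 𝒜 : Algorithm r, 𝒜.evacuationTime

end TriangleEvacuation

end

/-!
Write `h = 3 * y` for the height, and suppose that every exit is evacuated by time `T`.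

*What an exit imposes.* If neither trajectory visits the point `x` of the perimeter before time `t`,
then at every time `θ ≤ T` both agents, moving on their trajectories, are within
`max (T - θ) (θ - t + r)` of `x` (`IsSearch.dist_le`, proved for algorithms in `Algorithm.isSearch`).
Indeed, if the exit is at `x`, an agent that does not know it at time `θ` still has to get there by
time `T`, and one that was notified before has been within `r` of the other agent, which has been at
`x` at time `t` or later. Together with the fact that the trajectories visit the whole perimeter,
nothing else about algorithms is used.

*The bound `1.5 + y`* (`IsSearch.add_y_le`). Each agent needs time `y` to get to the perimeter and
then covers it with speed at most 1; the perimeter has length 3.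

*The bound `1 + 4 * y - r`* (`IsSearch.le_of_unvisitedBefore`). Suppose that `T` is smaller. One
agent visits two of the vertices, so some vertex `C` is unvisited before `1 + 2 * y`
(`IsSearch.unvisitedBefore_vertex`). Let `t ≤ 1 / 2 + y` be such that the other vertices `A`, `B`
are unvisited before `t`. Every vertex is at distance at least `h` from the opposite side. Hence
after time `T - h` no agent can be on `AB`, because of an exit at `C`, and none can be on `AC` or
`BC` before `t' = t + h - r`, because of exits at `B` and `A`. So the part `U` of the perimeter that
is unvisited at time `T - h` lies on `AC` and `BC`, and is unvisited before `t'`. Its length is more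
than 1, since until `T - h` each agent has had time less than 1 on the perimeter.

Let `k` and `k'` be the largest distances from `C` of points of `U` on `AC` and on `BC`. A point of
one of these sides at distance `d` from `C` is at distance at least `h * d` from the other side.
Exits at the points of `U` on one side therefore confine the visits of the other side after `T - h`
to two short time windows (`searchWindow`): an agent may be on `BC` only during `[t', T - h * k]`
and `[t' + h * k - r, T]`, and similarly for `AC` and `k'`. This bounds the length of `U`, and that
of its part on the side with the shorter windows, by the total length of windows. As `U` has length
at most `k + k'`, the windows turn out to be too short (`searching_times_contradiction`). When `t`
is small, the windows are longer, but then an agent has gone almost straight from the centroid to a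
vertex, has arrived at the perimeter later than at time `y` (`IsUnitTriangle.exists_entry_time`),
and `U` is longer as well.
-/

namespace TriangleEvacuation

open MeasureTheory Set

/-! ### Equilateral triangles of side 1 -/

theorem y_eq : y = √3 / 6 := by
  have h3 : √3 ^ 2 = 3 := Real.sq_sqrt (by norm_num)
  have : height = √3 / 2 := by
    rw [height, EuclideanSpace.dist_eq, ← Real.sqrt_sq (show (0 : ℝ) ≤ √3 / 2 by positivity)]
    congr 1
    simp [vertexA, vertexB, vertexC, Real.dist_eq, Fin.sum_univ_two, midpoint_eq_smul_add,
      sq_abs, div_pow, h3]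
  rw [y, this]
  ring

theorem y_pos : 0 < y := by
  rw [y_eq]
  positivity

theorem y_sq : y ^ 2 = 1 / 12 := by
  rw [y_eq, div_pow, Real.sq_sqrt (by norm_num)]
  norm_num

theorem y_gt : 0.28867 < y := by
  nlinarith [y_pos, y_sq]

theorem y_lt : y < 0.28868 := by
  nlinarith [y_pos, y_sq]

section Geometry

variable {E : Type*} [NormedAddCommGroup E] {A B C : E}

/-- The points `A`, `B`, `C` are the vertices of an equilateral triangle with side 1. -/
structure IsUnitTriangle (A B C : E) : Prop where
  dist_AB : dist A B = 1
  dist_BC : dist B C = 1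
  dist_CA : dist C A = 1

theorem IsUnitTriangle.rotate (h : IsUnitTriangle A B C) : IsUnitTriangle B C A :=
  ⟨h.dist_BC, h.dist_CA, h.dist_AB⟩

theorem IsUnitTriangle.swap (h : IsUnitTriangle A B C) : IsUnitTriangle B A C :=
  ⟨by rw [dist_comm, h.dist_AB], by rw [dist_comm, h.dist_CA], by rw [dist_comm, h.dist_BC]⟩

variable [InnerProductSpace ℝ E]

/-- The perimeter of the triangle with vertices `A`, `B`, `C`. -/
def trianglePerimeter (A B C : E) : Set E :=
  segment ℝ A B ∪ segment ℝ B C ∪ segment ℝ C A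

/-- The centroid of the triangle with vertices `A`, `B`, `C`. -/
noncomputable def triangleCentroid (A B C : E) : E := (3⁻¹ : ℝ) • (A + B + C)

theorem trianglePerimeter_rotate (A B C : E) :
    trianglePerimeter B C A = trianglePerimeter A B C := by
  rw [trianglePerimeter, union_comm, ← union_assoc, trianglePerimeter]

theorem triangleCentroid_rotate (A B C : E) :
    triangleCentroid B C A = triangleCentroid A B C := by
  rw [triangleCentroid, add_comm, ← add_assoc, triangleCentroid]

theorem triangleCentroid_swap (A B C : E) :
    triangleCentroid B A C = triangleCentroid A B C := by
  simp only [triangleCentroid, add_comm B A]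

/-- A point of a unit segment is determined by its distance from an endpoint. -/
theorem eq_add_dist_smul_of_mem_segment (h : dist A B = 1) {p : E} (hp : p ∈ segment ℝ A B) :
    dist p B ≤ 1 ∧ p = B + dist p B • (A - B) := by
  rw [segment_symm, segment_eq_image'] at hp
  obtain ⟨d, ⟨hd0, hd1⟩, rfl⟩ := hp
  have : dist (B + d • (A - B)) B = d := by
    rw [dist_eq_norm, add_sub_cancel_left, norm_smul, ← dist_eq_norm, h, mul_one,
      Real.norm_of_nonneg hd0]
  simp only [this]
  exact ⟨hd1, trivial⟩

/-- The norm in the affine coordinates of an equilateral triangle. -/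
theorem IsUnitTriangle.norm_sq (h : IsUnitTriangle A B C) (a b : ℝ) :
    ‖a • (A - C) + b • (B - C)‖ ^ 2 = a ^ 2 + a * b + b ^ 2 := by
  have hA : ‖A - C‖ = 1 := by rw [← dist_eq_norm, dist_comm, h.dist_CA]
  have hB : ‖B - C‖ = 1 := by rw [← dist_eq_norm, h.dist_BC]
  have hAB : ‖(A - C) - (B - C)‖ = 1 := by rw [sub_sub_sub_cancel_right, ← dist_eq_norm, h.dist_AB]
  have hin : inner ℝ (A - C) (B - C) = (1 / 2 : ℝ) := by
    have := norm_sub_sq_real (A - C) (B - C)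
    rw [hA, hB, hAB] at this
    linarith
  rw [norm_add_sq_real, norm_smul, norm_smul, inner_smul_left, inner_smul_right, hin, hA, hB,
    mul_one, mul_one, Real.norm_eq_abs, Real.norm_eq_abs, sq_abs, sq_abs]
  simp only [conj_trivial]
  ring

/-- A point of one side at distance `d` from an endpoint `C` is at distance at least `h * d` from
the other side through `C`, where `h = 3 * y` is the height. -/
theorem IsUnitTriangle.mul_dist_le_dist (h : IsUnitTriangle A B C) {z p : E}
    (hz : z ∈ segment ℝ A C) (hp : p ∈ segment ℝ B C) : 3 * y * dist z C ≤ dist p z := by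
  obtain ⟨-, hz⟩ := eq_add_dist_smul_of_mem_segment (by rw [dist_comm, h.dist_CA]) hz
  obtain ⟨-, hp⟩ := eq_add_dist_smul_of_mem_segment h.dist_BC hp
  have key := h.norm_sq (-dist z C) (dist p C)
  have : p - z = -dist z C • (A - C) + dist p C • (B - C) := by
    rw [neg_smul]
    nth_rewrite 1 [hz, hp]
    abel
  rw [← this, ← dist_eq_norm] at key
  refine abs_le_of_sq_le_sq' ?_ dist_nonneg |>.2
  rw [key, mul_pow, mul_pow, y_sq]
  nlinarith [sq_nonneg (dist z C - 2 * dist p C)]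

/-- The distance of a vertex from the opposite side is at least the height. -/
theorem IsUnitTriangle.height_le_dist (h : IsUnitTriangle A B C) {p : E}
    (hp : p ∈ segment ℝ B C) : 3 * y ≤ dist p A := by
  have := h.mul_dist_le_dist (left_mem_segment ℝ A C) hp
  rwa [dist_comm A C, h.dist_CA, mul_one] at this

/-- Pythagoras for the centroid, its projection to a side and a point of that side. -/
theorem IsUnitTriangle.dist_centroid_sq (h : IsUnitTriangle A B C) {p : E}
    (hp : p ∈ segment ℝ B C) :
    dist p (triangleCentroid A B C) ^ 2 = y ^ 2 + (1 / 2 - dist p C) ^ 2 := by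
  obtain ⟨-, hp⟩ := eq_add_dist_smul_of_mem_segment h.dist_BC hp
  have key := h.norm_sq (-3⁻¹) (dist p C - 3⁻¹)
  have : p - triangleCentroid A B C = (-3⁻¹ : ℝ) • (A - C) + (dist p C - 3⁻¹) • (B - C) := by
    nth_rewrite 1 [hp]
    rw [triangleCentroid]
    module
  rw [← this, ← dist_eq_norm] at key
  rw [key, y_sq]
  ring

/-- By symmetry, a property of the points of the perimeter need be checked on one side only. -/
theorem IsUnitTriangle.forall_mem_perimeter (h : IsUnitTriangle A B C) {P : E → Prop}
    (hP : ∀ A' B' C' : E, IsUnitTriangle A' B' C' →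
      triangleCentroid A' B' C' = triangleCentroid A B C → ∀ p ∈ segment ℝ B' C', P p) :
    ∀ p ∈ trianglePerimeter A B C, P p := by
  rintro p ((hp | hp) | hp)
  · exact hP C A B h.rotate.rotate (by rw [triangleCentroid_rotate, triangleCentroid_rotate]) p hp
  · exact hP A B C h rfl p hp
  · exact hP B C A h.rotate (triangleCentroid_rotate _ _ _) p hp

theorem IsUnitTriangle.y_le_dist_centroid (h : IsUnitTriangle A B C) {p : E}
    (hp : p ∈ trianglePerimeter A B C) : y ≤ dist p (triangleCentroid A B C) := by
  refine h.forall_mem_perimeter (P := fun p ↦ y ≤ dist p (triangleCentroid A B C)) ?_ p hp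
  intro A' B' C' h' hc p hp
  refine abs_le_of_sq_le_sq' ?_ dist_nonneg |>.2
  rw [← hc, h'.dist_centroid_sq hp]
  nlinarith [sq_nonneg (1 / 2 - dist p C')]

theorem IsUnitTriangle.dist_vertex_centroid (h : IsUnitTriangle A B C) :
    dist C (triangleCentroid A B C) = 2 * y := by
  have := h.dist_centroid_sq (right_mem_segment ℝ B C)
  rw [dist_self] at this
  refine (sq_eq_sq₀ dist_nonneg (by linarith [y_pos])).1 ?_
  rw [this, mul_pow, y_sq]
  norm_num

theorem IsUnitTriangle.inter_subset (h : IsUnitTriangle A B C) :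
    segment ℝ A C ∩ segment ℝ B C ⊆ {C} := by
  rintro p ⟨h1, h2⟩
  have := h.mul_dist_le_dist h1 h2
  rw [dist_self] at this
  have h3 : dist p C ≤ 0 := by
    by_contra! hc
    nlinarith [mul_pos y_pos hc]
  exact dist_le_zero.1 h3

end Geometry

/-! ### Length -/

section Length

variable {E : Type*} [NormedAddCommGroup E] [MeasurableSpace E] [BorelSpace E]

theorem hausdorffMeasure_image_le_volume {p : ℝ → E} (hp : LipschitzWith 1 p) (S : Set ℝ) :
    μH[1] (p '' S) ≤ volume S := by
  have := hp.hausdorffMeasure_image_le zero_le_one S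
  rwa [hausdorffMeasure_real, ENNReal.coe_one, ENNReal.one_rpow, one_mul] at this

variable [InnerProductSpace ℝ E] {A B C : E}

/-- The perimeter has length 3. -/
theorem IsUnitTriangle.three_le_hausdorffMeasure (h : IsUnitTriangle A B C) :
    3 ≤ μH[1] (trianglePerimeter A B C) := by
  have : NullSingletonClass (μH[1] : Measure E) :=
    Measure.nullSingletonClass_hausdorff E zero_lt_one
  have hm (P Q : E) : MeasurableSet (segment ℝ P Q) := by
    have : IsCompact (segment ℝ P Q) := by
      rw [segment_eq_image']
      exact isCompact_Icc.image (by fun_prop)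
    exact this.isClosed.measurableSet
  have hd {A B C : E} (h : IsUnitTriangle A B C) :
      μH[1] (segment ℝ A C ∩ segment ℝ B C) = 0 :=
    measure_mono_null h.inter_subset (measure_singleton C)
  have h1 : μH[1] (segment ℝ A B ∪ segment ℝ B C) = 2 := by
    rw [measure_union₀ (hm _ _).nullMeasurableSet, hausdorffMeasure_segment,
      hausdorffMeasure_segment, edist_dist, edist_dist, h.dist_AB, h.dist_BC]
    · norm_num
    · have := hd h.rotate.rotate.swap
      rwa [segment_symm ℝ C B] at this
  rw [trianglePerimeter, measure_union₀ (hm _ _).nullMeasurableSet, h1, hausdorffMeasure_segment,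
    edist_dist, h.dist_CA]
  · norm_num
  · refine measure_mono_null ?_ (measure_union_null (hd h.rotate.swap) (hd h))
    rintro p ⟨h1 | h1, h2⟩
    · left
      rw [segment_symm ℝ B A]
      exact ⟨h2, h1⟩
    · right
      rw [segment_symm ℝ A C]
      exact ⟨h2, h1⟩

/-- The part of a unit segment within distance `k` of an endpoint has length at most `k`. -/
theorem hausdorffMeasure_le_of_dist_le (hAC : dist A C = 1) {k : ℝ} (hk : 0 ≤ k) {U : Set E}
    (hU : U ⊆ segment ℝ A C) (hUk : ∀ z ∈ U, dist z C ≤ k) : μH[1] U ≤ ENNReal.ofReal k := by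
  have hsub : U ⊆ segment ℝ C (C + k • (A - C)) := by
    intro z hz
    obtain ⟨-, h2⟩ := eq_add_dist_smul_of_mem_segment hAC (hU hz)
    rcases hk.eq_or_lt with rfl | hk'
    · rw [le_antisymm (hUk z hz) dist_nonneg, zero_smul, add_zero] at h2
      rw [h2]
      exact left_mem_segment _ _ _
    rw [segment_eq_image']
    refine ⟨dist z C / k, ⟨by positivity, (div_le_one hk').2 (hUk z hz)⟩, ?_⟩
    simp only [add_sub_cancel_left, smul_smul, div_mul_cancel₀ _ hk'.ne']
    exact h2.symm
  refine (measure_mono hsub).trans ?_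
  rw [hausdorffMeasure_segment, edist_dist, dist_self_add_right, norm_smul, ← dist_eq_norm, hAC,
    mul_one, Real.norm_of_nonneg hk]

end Length

/-! ### Numerical estimates -/

/-- A linear bound for the time `n` at which an agent enters the perimeter in terms of the time `t` at
which it visits a vertex, from the quadratic inequality in `IsUnitTriangle.exists_entry_time`. -/
theorem le_add_of_quadratic {n t : ℝ} (hn : 0 < n)
    (h : 1 / 12 + (t - 1 / 2) ^ 2 ≤ n * (2 * t - 1)) : 0.595 ≤ n + 1.626 * (t - 1 / 2) := by
  have ht : 0 < t - 1 / 2 := by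
    by_contra! hc
    nlinarith [sq_nonneg (t - 1 / 2)]
  by_contra! hc
  -- the line is nearly tangent at `t - 1 / 2 = 0.14` to the hyperbola that bounds `n` from below
  nlinarith [mul_pos hn ht, sq_nonneg (t - 1 / 2 - 0.14)]

/-- The left-hand sides bound the length of the unvisited part of the perimeter at time `T - 3 * y`
from below, if one agent enters the perimeter at time `n` or later and the other one at time `y` or
later. The maxima are the lengths of the time windows left for visiting it, and `k`, `k'` are its
extents on two sides. The hypothesis `h1` gives an upper bound for `k` and `h2` one for `k'`; they
contradict `h3`. -/
theorem searching_times_contradiction {T r t n k k' : ℝ} (hr : 0 ≤ r) (hT : T < 1 + 4 * y - r)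
    (ht : 0 ≤ t) (hn : y ≤ n) (hnt : 0.595 ≤ n + 1.626 * (t - 1 / 2)) (hk' : k' ≤ 1)
    (h1 : 3 - 2 * (T - 3 * y) + n + y ≤ 2 * (max (T - (t + 3 * y - r) - 3 * y * k) 0 +
      max (T - (t + 3 * y - r) - 3 * y * k + r) 0))
    (h2 : 3 - 2 * (T - 3 * y) + n + y ≤ 2 * (max (T - (t + 3 * y - r) - 3 * y * k') 0 +
      max (T - (t + 3 * y - r) - 3 * y * k' + r) 0) + k')
    (h3 : 3 - 2 * (T - 3 * y) + n + y ≤ k + k') : False := by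
  have hy := y_pos
  have hy2 := y_sq
  have hgt := y_gt
  have hlt := y_lt
  have e1 : 1 - y + n + 12 * y * k < 4 * (1 + y - t) := by
    rcases le_total 0 (T - (t + 3 * y - r) - 3 * y * k) with h | h
    · rw [max_eq_left h, max_eq_left (by linarith)] at h1
      linarith
    · have : max (T - (t + 3 * y - r) - 3 * y * k + r) 0 ≤ r := max_le (by linarith) hr
      rw [max_eq_right h] at h1
      linarith
  have e2 : 1 - y + n + (12 * y - 1) * k' < 4 * (1 + y - t) := by
    rcases le_total 0 (T - (t + 3 * y - r) - 3 * y * k') with h | h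
    · rw [max_eq_left h, max_eq_left (by linarith)] at h2
      linarith
    · have : max (T - (t + 3 * y - r) - 3 * y * k' + r) 0 ≤ r := max_le (by linarith) hr
      rw [max_eq_right h] at h2
      linarith
  have e3 : 1 - y + n < k + k' := by linarith
  have f1 := mul_lt_mul_of_pos_left e1 (show 0 < 12 * y - 1 by linarith)
  have f2 := mul_lt_mul_of_pos_left e2 (show 0 < 12 * y by linarith)
  have f3 := mul_lt_mul_of_pos_left e3
    (mul_pos (show 0 < 12 * y by linarith) (show 0 < 12 * y - 1 by linarith))
  have f4 : (11 + 12 * y) * (1 - y + n) < 4 * (24 * y - 1) * (1 + y - t) := by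
    have hc : (12 * y) * (12 * y - 1) = 12 - 12 * y := by linear_combination 144 * hy2
    linear_combination f1 + f2 + f3 - (1 - y + n) * hc
  have f5 := mul_le_mul_of_nonneg_left hnt (show 0 ≤ 11 + 12 * y by linarith)
  have f6 : 0 ≤ (4 * (24 * y - 1) - (11 + 12 * y) * 1.626) * t :=
    mul_nonneg (by linarith) ht
  nlinarith

/-! ### Searching the perimeter with two agents -/

section Search

variable {E : Type*} [NormedAddCommGroup E]

/-- No agent is at the point `x` before time `t`. -/
def UnvisitedBefore (p : Fin 2 → ℝ → E) (x : E) (t : ℝ) : Prop :=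
  ∀ i, ∀ s ∈ Ico 0 t, p i s ≠ x

/-- Visits to a closed set by a continuous curve have a first time. -/
theorem exists_first_visit {q : ℝ → E} (hq : Continuous q) {F : Set E} (hF : IsClosed F) {t : ℝ}
    (ht : 0 ≤ t) (hqt : q t ∈ F) :
    ∃ n, 0 ≤ n ∧ n ≤ t ∧ q n ∈ F ∧ ∀ s, 0 ≤ s → q s ∈ F → n ≤ s := by
  have hcl : IsClosed (Ici 0 ∩ q ⁻¹' F) := isClosed_Ici.inter (hF.preimage hq)
  have hbd : BddBelow (Ici 0 ∩ q ⁻¹' F) := ⟨0, fun s hs ↦ hs.1⟩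
  have hmem := hcl.csInf_mem ⟨t, ht, hqt⟩ hbd
  exact ⟨_, hmem.1, csInf_le hbd ⟨ht, hqt⟩, hmem.2, fun s hs hsF ↦ csInf_le hbd ⟨hs, hsF⟩⟩

theorem dist_le_sub_of_lipschitz {q : ℝ → E} (hq : LipschitzWith 1 q) {s t : ℝ} (hst : s ≤ t) :
    dist (q s) (q t) ≤ t - s := by
  have := hq.dist_le_mul s t
  rwa [NNReal.coe_one, one_mul, Real.dist_eq, abs_sub_comm, abs_of_nonneg (by linarith)] at this

variable [InnerProductSpace ℝ E]

theorem isClosed_trianglePerimeter (A B C : E) : IsClosed (trianglePerimeter A B C) := by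
  have hm (P Q : E) : IsClosed (segment ℝ P Q) := by
    rw [segment_eq_image']
    exact (isCompact_Icc.image (by fun_prop)).isClosed
  exact ((hm _ _).union (hm _ _)).union (hm _ _)

/-- Two unit speed curves from the centroid that visit every point of the perimeter by time `T`, and
that can serve as the trajectories of an algorithm with range `r` and evacuation time at most `T`:
the field `dist_le` is the constraint that an exit at `x` imposes. An agent which does not know the
exit at time `θ` still has to reach it, and an agent which knows it has come within `r` of a point
reachable from `x` since the visit of `x`. -/
structure IsSearch (A B C : E) (p : Fin 2 → ℝ → E) (T r : ℝ) : Prop where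
  lipschitz : ∀ i, LipschitzWith 1 (p i)
  start : ∀ i, p i 0 = triangleCentroid A B C
  cover : ∀ x ∈ trianglePerimeter A B C, ∃ i, ∃ s ∈ Icc 0 T, p i s = x
  dist_le : ∀ x ∈ trianglePerimeter A B C, ∀ t, UnvisitedBefore p x t →
    ∀ i, ∀ θ ∈ Icc 0 T, dist (p i θ) x ≤ max (T - θ) (θ - t + r)

variable {A B C : E} {p : Fin 2 → ℝ → E} {T r : ℝ}

theorem IsSearch.rotate (hp : IsSearch A B C p T r) : IsSearch B C A p T r :=
  ⟨hp.lipschitz, by simpa only [triangleCentroid_rotate] using hp.start,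
    by simpa only [trianglePerimeter_rotate] using hp.cover,
    by simpa only [trianglePerimeter_rotate] using hp.dist_le⟩

theorem IsUnitTriangle.y_le_time (h : IsUnitTriangle A B C) {q : ℝ → E} (hq : LipschitzWith 1 q)
    (h0 : q 0 = triangleCentroid A B C) {s : ℝ} (hs : 0 ≤ s)
    (hqs : q s ∈ trianglePerimeter A B C) : y ≤ s := by
  have h1 := dist_le_sub_of_lipschitz hq hs
  have h2 := h.y_le_dist_centroid hqs
  rw [h0, dist_comm] at h1
  linarith

/-- An agent that visits a vertex early has lost time before reaching the perimeter: the closer to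
the vertex it enters the perimeter, the later. -/
theorem IsUnitTriangle.exists_entry_time (h : IsUnitTriangle A B C) {q : ℝ → E}
    (hq : LipschitzWith 1 q) (h0 : q 0 = triangleCentroid A B C) {t : ℝ} (ht0 : 0 ≤ t)
    (ht : t < 1 / 2 + y) (hqt : q t = C) :
    ∃ n, y ≤ n ∧ n ≤ t ∧ (∀ s, 0 ≤ s → q s ∈ trianglePerimeter A B C → n ≤ s) ∧
      0.595 ≤ n + 1.626 * (t - 1 / 2) := by
  have hC : C ∈ trianglePerimeter A B C := Or.inl (Or.inr (right_mem_segment ℝ B C))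
  obtain ⟨n, hn0, hnt, hnP, hn⟩ := exists_first_visit hq.continuous
    (isClosed_trianglePerimeter A B C) ht0 (hqt ▸ hC)
  have hyn := h.y_le_time hq h0 hn0 hnP
  refine ⟨n, hyn, hnt, hn, le_add_of_quadratic (y_pos.trans_le hyn) ?_⟩
  have hzC := dist_le_sub_of_lipschitz hq hnt
  rw [hqt] at hzC
  have hzO := dist_le_sub_of_lipschitz hq hn0
  rw [h0, sub_zero, dist_comm] at hzO
  have hyg := y_gt
  have key : dist (q n) (triangleCentroid A B C) ^ 2 = y ^ 2 + (1 / 2 - dist (q n) C) ^ 2 →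
      1 / 12 + (t - 1 / 2) ^ 2 ≤ n * (2 * t - 1) := by
    intro hsq
    rw [y_sq] at hsq
    have e1 : dist (q n) (triangleCentroid A B C) ^ 2 ≤ n ^ 2 :=
      pow_le_pow_left₀ dist_nonneg hzO 2
    have e2 : (1 / 2 - (t - n)) ^ 2 ≤ (1 / 2 - dist (q n) C) ^ 2 :=
      pow_le_pow_left₀ (by linarith) (by linarith) 2
    nlinarith
  rcases hnP with (hz | hz) | hz
  · have := h.rotate.rotate.height_le_dist hz
    linarith
  · exact key (h.dist_centroid_sq hz)
  · rw [segment_symm] at hz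
    have := h.swap.dist_centroid_sq hz
    rw [triangleCentroid_swap] at this
    exact key this

theorem IsSearch.unvisitedBefore_vertex (hp : IsSearch A B C p T r) (h : IsUnitTriangle A B C) :
    UnvisitedBefore p A (1 + 2 * y) ∨ UnvisitedBefore p B (1 + 2 * y) ∨
      UnvisitedBefore p C (1 + 2 * y) := by
  -- an agent needs time `2 * y` for its first vertex and `1` more for a second one
  have two {P Q : E} (hP : dist P (triangleCentroid A B C) = 2 * y)
      (hQ : dist Q (triangleCentroid A B C) = 2 * y) (hPQ : dist P Q = 1) {i : Fin 2} {s t : ℝ}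
      (hs : s ∈ Ico 0 (1 + 2 * y)) (ht : t ∈ Ico 0 (1 + 2 * y)) (hsP : p i s = P)
      (htQ : p i t = Q) : False := by
    have h1 := dist_le_sub_of_lipschitz (hp.lipschitz i) hs.1
    have h2 := dist_le_sub_of_lipschitz (hp.lipschitz i) ht.1
    rw [hp.start, dist_comm, hsP, hP] at h1
    rw [hp.start, dist_comm, htQ, hQ] at h2
    rcases le_total s t with hst | hst
    · have h3 := dist_le_sub_of_lipschitz (hp.lipschitz i) hst
      rw [hsP, htQ, hPQ] at h3
      linarith [ht.2]
    · have h3 := dist_le_sub_of_lipschitz (hp.lipschitz i) hst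
      rw [hsP, htQ, dist_comm, hPQ] at h3
      linarith [hs.2]
  have hC := h.dist_vertex_centroid
  have hA := h.rotate.dist_vertex_centroid
  have hB := h.rotate.rotate.dist_vertex_centroid
  rw [triangleCentroid_rotate] at hA
  rw [triangleCentroid_rotate, triangleCentroid_rotate] at hB
  by_contra! hcon
  simp only [UnvisitedBefore] at hcon
  push Not at hcon
  obtain ⟨⟨i, s, hs, hsA⟩, ⟨j, t, ht, htB⟩, ⟨l, v, hv, hvC⟩⟩ := hcon
  have : i = j ∨ j = l ∨ l = i := by omega
  rcases this with rfl | rfl | rfl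
  · exact two hA hB h.dist_AB hs ht hsA htB
  · exact two hB hC h.dist_BC ht hv htB hvC
  · exact two hC hA h.dist_CA hv hs hvC hsA

/-- Here `t` is the time of the first visit of `A` or `B`, capped at `1 / 2 + y`, and `ν i` is a time
before which agent `i` is not on the perimeter: it is `n` for the agent that makes this visit, if
there is one before `1 / 2 + y`, and `y` otherwise. -/
theorem IsSearch.exists_first_vertex_time (hp : IsSearch A B C p T r) (h : IsUnitTriangle A B C) :
    ∃ t n : ℝ, ∃ ν : Fin 2 → ℝ, 0 ≤ t ∧ UnvisitedBefore p A t ∧ UnvisitedBefore p B t ∧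
      y ≤ n ∧ 0.595 ≤ n + 1.626 * (t - 1 / 2) ∧ ν 0 + ν 1 = n + y ∧ (∀ i, ν i ≤ 1 / 2 + y) ∧
      ∀ i s, 0 ≤ s → p i s ∈ trianglePerimeter A B C → ν i ≤ s := by
  have hyg := y_gt
  have hy0 (i) (s) (hs : 0 ≤ s) (hps : p i s ∈ trianglePerimeter A B C) : y ≤ s :=
    h.y_le_time (hp.lipschitz i) (hp.start i) hs hps
  -- the first time `t` at which some agent is at `A` or `B`
  have hcl : IsClosed {s : ℝ | 0 ≤ s ∧ ∃ i, p i s ∈ ({A, B} : Set E)} := by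
    have : {s : ℝ | 0 ≤ s ∧ ∃ i, p i s ∈ ({A, B} : Set E)} =
        Ici 0 ∩ ⋃ i, p i ⁻¹' {A, B} := by
      ext s
      simp
    rw [this]
    exact isClosed_Ici.inter (isClosed_iUnion_of_finite fun i ↦
      (Set.toFinite _).isClosed.preimage (hp.lipschitz i).continuous)
  have hbd : BddBelow {s : ℝ | 0 ≤ s ∧ ∃ i, p i s ∈ ({A, B} : Set E)} := ⟨0, fun s hs ↦ hs.1⟩
  have hA : A ∈ trianglePerimeter A B C := Or.inl (Or.inl (left_mem_segment ℝ A B))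
  obtain ⟨i₀, s₀, hs₀, hsA⟩ := hp.cover A hA
  obtain ⟨ht0, i, hi⟩ := hcl.csInf_mem ⟨s₀, hs₀.1, i₀, by simp [hsA]⟩ hbd
  have hfirst : ∀ s, 0 ≤ s → ∀ j, p j s ∈ ({A, B} : Set E) →
      sInf {s : ℝ | 0 ≤ s ∧ ∃ i, p i s ∈ ({A, B} : Set E)} ≤ s :=
    fun s hs j hj ↦ csInf_le hbd ⟨hs, j, hj⟩
  generalize sInf {s : ℝ | 0 ≤ s ∧ ∃ i, p i s ∈ ({A, B} : Set E)} = t at ht0 hi hfirst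
  rcases le_or_gt (1 / 2 + y) t with ht | ht
  · refine ⟨1 / 2 + y, y, fun _ ↦ y, by linarith, ?_, ?_, le_rfl, by linarith, rfl,
      fun _ ↦ by linarith, hy0⟩
    · intro j s hs hj
      linarith [hfirst s hs.1 j (by simp [hj]), hs.2]
    · intro j s hs hj
      linarith [hfirst s hs.1 j (by simp [hj]), hs.2]
  · obtain ⟨n, hyn, hnt, hn, hn'⟩ : ∃ n, y ≤ n ∧ n ≤ t ∧
        (∀ s, 0 ≤ s → p i s ∈ trianglePerimeter A B C → n ≤ s) ∧
        0.595 ≤ n + 1.626 * (t - 1 / 2) := by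
      rcases hi with hi | hi
      · have := h.rotate.exists_entry_time (hp.lipschitz i) (hp.rotate.start i) ht0 ht hi
        rwa [trianglePerimeter_rotate] at this
      · have := h.rotate.rotate.exists_entry_time (hp.lipschitz i) (hp.rotate.rotate.start i)
          ht0 ht hi
        rwa [trianglePerimeter_rotate, trianglePerimeter_rotate] at this
    refine ⟨t, n, fun j ↦ if j = i then n else y, ht0, ?_, ?_, hyn, hn', ?_, ?_, ?_⟩
    · intro j s hs hj
      linarith [hfirst s hs.1 j (by simp [hj]), hs.2]
    · intro j s hs hj
      linarith [hfirst s hs.1 j (by simp [hj]), hs.2]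
    · fin_cases i
      · simp
      · simp [add_comm]
    · intro j
      dsimp only
      split_ifs <;> linarith
    · intro j s hs hj
      dsimp only
      split_ifs with hji
      · exact hn s hs (hji ▸ hj)
      · exact hy0 j s hs hj

end Search

/-! ### Lower bounds for searches -/

section Bounds

variable {E : Type*} [NormedAddCommGroup E] [MeasurableSpace E] [BorelSpace E]
  {A B C : E} {p : Fin 2 → ℝ → E} {T r : ℝ}

/-- Points visited by two unit speed agents during `S 0` and `S 1` have total length at most that of
the two sets of times. -/
theorem hausdorffMeasure_iUnion_image_le (hp : ∀ i, LipschitzWith 1 (p i)) (S : Fin 2 → Set ℝ) :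
    μH[1] (⋃ i, p i '' S i) ≤ volume (S 0) + volume (S 1) := by
  refine (measure_iUnion_fintype_le _ _).trans ?_
  rw [Fin.sum_univ_two]
  exact add_le_add (hausdorffMeasure_image_le_volume (hp 0) _)
    (hausdorffMeasure_image_le_volume (hp 1) _)

variable [InnerProductSpace ℝ E]

/-- The two agents together need time `3` on the perimeter and arrive there at time `y`. -/
theorem IsSearch.add_y_le (hp : IsSearch A B C p T r) (h : IsUnitTriangle A B C) :
    3 / 2 + y ≤ T := by
  have hsub : trianglePerimeter A B C ⊆ ⋃ i, p i '' Icc y T := by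
    intro x hx
    obtain ⟨i, s, hs, rfl⟩ := hp.cover x hx
    exact mem_iUnion.2 ⟨i, s, ⟨h.y_le_time (hp.lipschitz i) (hp.start i) hs.1 hx, hs.2⟩, rfl⟩
  have h3 := h.three_le_hausdorffMeasure.trans
    ((measure_mono hsub).trans (hausdorffMeasure_iUnion_image_le hp.lipschitz fun _ ↦ Icc y T))
  rw [Real.volume_Icc] at h3
  by_contra! hT
  have : ENNReal.ofReal (T - y) + ENNReal.ofReal (T - y) < 3 := by
    rcases le_total (T - y) 0 with h0 | h0
    · rw [ENNReal.ofReal_of_nonpos h0]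
      norm_num
    · rw [← ENNReal.ofReal_add h0 h0, ← ENNReal.ofReal_ofNat 3,
        ENNReal.ofReal_lt_ofReal_iff (by norm_num)]
      linarith
  exact absurd h3 this.not_ge

/-- The times in `[t', T]` at which an agent may be at distance at least `d` from a point not
visited before `t'`. -/
def searchWindow (T r t' d : ℝ) : Set ℝ := Icc t' (T - d) ∪ Icc (t' + d - r) T

theorem volume_searchWindow_le (T r t' d : ℝ) :
    volume (searchWindow T r t' d) ≤
      ENNReal.ofReal (max (T - t' - d) 0 + max (T - t' - d + r) 0) := by
  refine (measure_union_le _ _).trans ?_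
  rw [Real.volume_Icc, Real.volume_Icc, ENNReal.ofReal_add (le_max_right _ _) (le_max_right _ _)]
  refine add_le_add (ENNReal.ofReal_le_ofReal ?_) (ENNReal.ofReal_le_ofReal ?_)
  · exact le_max_of_le_left (by linarith)
  · exact le_max_of_le_left (by linarith)

/-- The case in which `C` is the last vertex to be visited. -/
theorem IsSearch.le_of_unvisitedBefore (hp : IsSearch A B C p T r) (h : IsUnitTriangle A B C)
    (hC : UnvisitedBefore p C (1 + 2 * y)) (hr : 0 ≤ r) : 1 + 4 * y - r ≤ T := by
  by_contra! hT
  have hyg := y_gt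
  have hyl := y_lt
  have hT1 := hp.add_y_le h
  obtain ⟨t, n, ν, ht0, htA, htB, hyn, hnt, hν, hν', hνP⟩ := hp.exists_first_vertex_time h
  have hAP : A ∈ trianglePerimeter A B C := Or.inl (Or.inl (left_mem_segment ℝ A B))
  have hBP : B ∈ trianglePerimeter A B C := Or.inl (Or.inl (right_mem_segment ℝ A B))
  have hCP : C ∈ trianglePerimeter A B C := Or.inl (Or.inr (right_mem_segment ℝ B C))
  -- after time `T - 3 * y` the agents are on the sides through `C` only, and from `t'` on
  set t' := t + 3 * y - r with ht'
  have hAB (i : Fin 2) {s : ℝ} (hs : s ∈ Ioc (T - 3 * y) T) : p i s ∉ segment ℝ A B := by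
    intro hps
    have h1 := h.rotate.rotate.height_le_dist hps
    rcases le_max_iff.1 (h1.trans (hp.dist_le C hCP _ hC i s ⟨by linarith [hs.1], hs.2⟩))
      with h2 | h2
    · linarith [hs.1]
    · linarith [hs.2]
  have hAC (i : Fin 2) {s : ℝ} (hs : s ∈ Ioc (T - 3 * y) T) (hps : p i s ∈ segment ℝ A C) :
      t' ≤ s := by
    have h1 := h.swap.height_le_dist hps
    rcases le_max_iff.1 (h1.trans (hp.dist_le B hBP _ htB i s ⟨by linarith [hs.1], hs.2⟩))
      with h2 | h2
    · linarith [hs.1]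
    · linarith
  have hBC (i : Fin 2) {s : ℝ} (hs : s ∈ Ioc (T - 3 * y) T) (hps : p i s ∈ segment ℝ B C) :
      t' ≤ s := by
    have h1 := h.height_le_dist hps
    rcases le_max_iff.1 (h1.trans (hp.dist_le A hAP _ htA i s ⟨by linarith [hs.1], hs.2⟩))
      with h2 | h2
    · linarith [hs.1]
    · linarith
  -- the part `U` of the perimeter which is unvisited at time `T - 3 * y`
  set U : Set E := {x ∈ trianglePerimeter A B C | ∀ i, ∀ s ∈ Icc 0 (T - 3 * y), p i s ≠ x} with hU
  have hUcover {x : E} (hx : x ∈ U) : ∃ i, ∃ s ∈ Ioc (T - 3 * y) T, p i s = x := by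
    obtain ⟨i, s, hs, hsx⟩ := hp.cover x hx.1
    refine ⟨i, s, ⟨?_, hs.2⟩, hsx⟩
    by_contra! hc
    exact hx.2 i s ⟨hs.1, hc⟩ hsx
  have hUside {x : E} (hx : x ∈ U) : x ∈ segment ℝ A C ∨ x ∈ segment ℝ B C := by
    obtain ⟨i, s, hs, rfl⟩ := hUcover hx
    rcases hx.1 with (h1 | h1) | h1
    · exact absurd h1 (hAB i hs)
    · exact Or.inr h1
    · rw [segment_symm] at h1
      exact Or.inl h1
  have hside (i : Fin 2) {s : ℝ} (hs : s ∈ Ioc (T - 3 * y) T) (hps : p i s ∈ U) : t' ≤ s :=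
    (hUside hps).elim (hAC i hs) (hBC i hs)
  have hUunv {x : E} (hx : x ∈ U) : UnvisitedBefore p x t' := by
    obtain ⟨j, v, hv, rfl⟩ := hUcover hx
    intro i s hs hsx
    rcases le_or_gt s (T - 3 * y) with h1 | h1
    · exact hx.2 i s ⟨hs.1, h1⟩ hsx
    · exact (hside i ⟨h1, by linarith [hs.2, hside j hv hx, hv.2]⟩ (hsx ▸ hx)).not_gt hs.2
  -- `k` and `k'` measure how far `U` extends from `C` on the two sides
  have hone {x : E} (hx : x ∈ U) : dist x C ≤ 1 := by
    rcases hUside hx with h1 | h1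
    · exact (eq_add_dist_smul_of_mem_segment (by rw [dist_comm, h.dist_CA]) h1).1
    · exact (eq_add_dist_smul_of_mem_segment h.dist_BC h1).1
  have hbd (S : Set E) : BddAbove ((dist · C) '' (U ∩ S)) := by
    refine ⟨1, ?_⟩
    rintro _ ⟨x, hx, rfl⟩
    exact hone hx.1
  set k := sSup ((dist · C) '' (U ∩ segment ℝ A C)) with hk
  set k' := sSup ((dist · C) '' (U ∩ segment ℝ B C)) with hk'
  have hnonneg (S : Set E) : 0 ≤ sSup ((dist · C) '' (U ∩ S)) := by
    refine Real.sSup_nonneg ?_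
    rintro _ ⟨x, -, rfl⟩
    exact dist_nonneg
  have hle1 (S : Set E) : sSup ((dist · C) '' (U ∩ S)) ≤ 1 := by
    refine Real.sSup_le ?_ zero_le_one
    rintro _ ⟨x, hx, rfl⟩
    exact hone hx.1
  have hk0 : 0 ≤ k := hnonneg _
  have hk0' : 0 ≤ k' := hnonneg _
  have hk1 : k ≤ 1 := hle1 _
  have hk1' : k' ≤ 1 := hle1 _
  -- visits of one side of `C` fall into the window determined by the other side
  have hwin (S : Set E) {i : Fin 2} {s : ℝ} (hs : s ∈ Ioc (T - 3 * y) T) (hts : t' ≤ s)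
      (hd : ∀ x ∈ U ∩ S, 3 * y * dist x C ≤ dist (p i s) x) :
      s ∈ searchWindow T r t' (3 * y * sSup ((dist · C) '' (U ∩ S))) := by
    have h0 : 0 ≤ max (T - s) (s - t' + r) := le_max_of_le_left (by linarith [hs.2])
    have h1 : sSup ((dist · C) '' (U ∩ S)) ≤ max (T - s) (s - t' + r) / (3 * y) := by
      refine Real.sSup_le ?_ (div_nonneg h0 (by linarith))
      rintro _ ⟨x, hx, rfl⟩
      rw [le_div_iff₀' (by linarith)]
      exact (hd x hx).trans
        (hp.dist_le x hx.1.1 t' (hUunv hx.1) i s ⟨by linarith [hs.1], hs.2⟩)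
    rw [le_div_iff₀' (by linarith)] at h1
    rcases le_max_iff.1 h1 with h2 | h2
    · exact Or.inl ⟨hts, by linarith⟩
    · exact Or.inr ⟨by linarith, hs.2⟩
  have hwinA {x : E} (hx : x ∈ U ∩ segment ℝ A C) :
      x ∈ ⋃ i, p i '' searchWindow T r t' (3 * y * k') := by
    obtain ⟨i, s, hs, rfl⟩ := hUcover hx.1
    exact mem_iUnion.2 ⟨i, s, hwin _ hs (hAC i hs hx.2)
      fun z hz ↦ h.swap.mul_dist_le_dist hz.2 hx.2, rfl⟩
  have hwinB {x : E} (hx : x ∈ U ∩ segment ℝ B C) :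
      x ∈ ⋃ i, p i '' searchWindow T r t' (3 * y * k) := by
    obtain ⟨i, s, hs, rfl⟩ := hUcover hx.1
    exact mem_iUnion.2 ⟨i, s, hwin _ hs (hBC i hs hx.2)
      fun z hz ↦ h.mul_dist_le_dist hz.2 hx.2, rfl⟩
  have hanti {d d' : ℝ} (hdd : d ≤ d') :
      searchWindow T r t' (3 * y * d') ⊆ searchWindow T r t' (3 * y * d) := by
    have := mul_le_mul_of_nonneg_left hdd (show 0 ≤ 3 * y by linarith)
    exact union_subset_union (Icc_subset_Icc_right (by linarith))
      (Icc_subset_Icc_left (by linarith))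
  -- lengths of `U` and of its parts on the two sides
  have hUunion : U ⊆ (U ∩ segment ℝ A C) ∪ (U ∩ segment ℝ B C) := fun x hx ↦
    (hUside hx).imp (fun h1 ↦ ⟨hx, h1⟩) fun h1 ↦ ⟨hx, h1⟩
  have hUle : μH[1] U ≤ μH[1] (U ∩ segment ℝ A C) + μH[1] (U ∩ segment ℝ B C) :=
    (measure_mono hUunion).trans (measure_union_le _ _)
  have hlenA : μH[1] (U ∩ segment ℝ A C) ≤ ENNReal.ofReal k :=
    hausdorffMeasure_le_of_dist_le (by rw [dist_comm, h.dist_CA]) hk0 inter_subset_right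
      fun z hz ↦ le_csSup (hbd _) ⟨z, hz, rfl⟩
  have hlenB : μH[1] (U ∩ segment ℝ B C) ≤ ENNReal.ofReal k' :=
    hausdorffMeasure_le_of_dist_le h.dist_BC hk0' inter_subset_right
      fun z hz ↦ le_csSup (hbd _) ⟨z, hz, rfl⟩
  have hcov {V : Set E} {d : ℝ} (hV : V ⊆ ⋃ i, p i '' searchWindow T r t' d) :
      μH[1] V ≤ ENNReal.ofReal (2 * (max (T - t' - d) 0 + max (T - t' - d + r) 0)) := by
    refine (measure_mono hV).trans ((hausdorffMeasure_iUnion_image_le hp.lipschitz _).trans ?_)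
    rw [two_mul, ENNReal.ofReal_add (by positivity) (by positivity)]
    exact add_le_add (volume_searchWindow_le _ _ _ _) (volume_searchWindow_le _ _ _ _)
  -- what has been visited until time `T - 3 * y`
  have hlow {c : ℝ} (hc0 : 0 ≤ c) (hc : μH[1] U ≤ ENNReal.ofReal c) :
      3 - 2 * (T - 3 * y) + n + y ≤ c := by
    have hsub : trianglePerimeter A B C ⊆ (⋃ i, p i '' Icc (ν i) (T - 3 * y)) ∪ U := by
      intro x hx
      by_cases hxU : x ∈ U
      · exact Or.inr hxU
      · simp only [hU, mem_ofPred_eq, hx, true_and, ne_eq] at hxU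
        push Not at hxU
        obtain ⟨i, s, hs, rfl⟩ := hxU
        exact Or.inl (mem_iUnion.2 ⟨i, s, ⟨hνP i s hs.1 hx, hs.2⟩, rfl⟩)
    have h3 := h.three_le_hausdorffMeasure.trans ((measure_mono hsub).trans
      ((measure_union_le _ _).trans (add_le_add (hausdorffMeasure_iUnion_image_le hp.lipschitz
        fun i ↦ Icc (ν i) (T - 3 * y)) hc)))
    rw [Real.volume_Icc, Real.volume_Icc,
      ← ENNReal.ofReal_add (by linarith [hν' 0]) (by linarith [hν' 1]),
      ← ENNReal.ofReal_add (by linarith [hν' 0, hν' 1]) hc0, ← ENNReal.ofReal_ofNat 3,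
      ENNReal.ofReal_le_ofReal_iff (by linarith [hν' 0, hν' 1])] at h3
    linarith
  have hsum : 3 - 2 * (T - 3 * y) + n + y ≤ k + k' := by
    refine hlow (by linarith) (hUle.trans ?_)
    rw [ENNReal.ofReal_add hk0 hk0']
    exact add_le_add hlenA hlenB
  rcases le_total k k' with hkk | hkk
  · refine searching_times_contradiction hr hT ht0 hyn hnt hk1' (hlow (by positivity) ?_)
      (hlow (by positivity) ?_) hsum
    · exact hcov fun x hx ↦ (hUunion hx).elim
        (fun hx ↦ iUnion_mono (fun i ↦ image_mono (hanti hkk)) (hwinA hx)) hwinB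
    · rw [ENNReal.ofReal_add (by positivity) hk0']
      exact hUle.trans (add_le_add (hcov fun x ↦ hwinA) hlenB)
  · refine searching_times_contradiction hr hT ht0 hyn hnt hk1 (k := k') (hlow (by positivity) ?_)
      (hlow (by positivity) ?_) (by linarith)
    · exact hcov fun x hx ↦ (hUunion hx).elim hwinA
        (fun hx ↦ iUnion_mono (fun i ↦ image_mono (hanti hkk)) (hwinB hx))
    · rw [add_comm, ENNReal.ofReal_add hk0 (by positivity)]
      exact hUle.trans (add_le_add hlenA (hcov fun x ↦ hwinB))

theorem IsSearch.add_four_mul_y_le (hp : IsSearch A B C p T r) (h : IsUnitTriangle A B C)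
    (hr : 0 ≤ r) : 1 + 4 * y - r ≤ T := by
  rcases hp.unvisitedBefore_vertex h with hA | hB | hC
  · exact hp.rotate.le_of_unvisitedBefore h.rotate hA hr
  · exact hp.rotate.rotate.le_of_unvisitedBefore h.rotate.rotate hB hr
  · exact hp.le_of_unvisitedBefore h hC hr

end Bounds

/-! ### From algorithms to searches -/

section Algorithm

variable {r : ℝ} {T : ℝ≥0}

/-- The assigned trajectories, extended to negative times by the starting point. -/
noncomputable def Algorithm.path (𝒜 : Algorithm r) (i : Fin 2) (s : ℝ) : Plane :=
  𝒜.trajectory i s.toNNReal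

theorem IsMotion.dist_le {p : ℝ≥0 → Plane} (hp : IsMotion p) {s t : ℝ≥0} (hst : s ≤ t) :
    dist (p t) (p s) ≤ t - s := by
  have := hp.2.dist_le_mul t s
  rwa [NNReal.coe_one, one_mul, NNReal.dist_eq,
    abs_of_nonneg (sub_nonneg.2 (NNReal.coe_le_coe.2 hst))] at this

variable (𝒜 : Algorithm r) {x : Plane}

/-- By continuity, an agent is still on its trajectory at the end of its time of ignorance. -/
theorem Algorithm.motion_eq_trajectory (hx : x ∈ perimeter) {i : Fin 2} {u : ℝ≥0}
    (hu : ∀ s < u, ¬ KnowsExit r (𝒜.motion x) x i s) :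
    𝒜.motion x i u = 𝒜.trajectory i u := by
  rcases eq_or_ne u 0 with rfl | h0
  · rw [(𝒜.isMotion_motion x hx i).1, (𝒜.isMotion_trajectory i).1]
  have hcl : IsClosed {s | 𝒜.motion x i s = 𝒜.trajectory i s} :=
    isClosed_eq (𝒜.isMotion_motion x hx i).2.continuous (𝒜.isMotion_trajectory i).2.continuous
  have hsub : Iio u ⊆ {s | 𝒜.motion x i s = 𝒜.trajectory i s} :=
    fun s hs ↦ 𝒜.follows_trajectory x hx i s (hu s hs)
  have := hcl.closure_subset_iff.2 hsub
  rw [closure_Iio' ⟨0, pos_iff_ne_zero.2 h0⟩] at this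
  exact this self_mem_Iic

/-- The exit cannot be reached before it has been found on an assigned trajectory. -/
theorem Algorithm.exists_trajectory_eq (hx : x ∈ perimeter) {j : Fin 2} {u : ℝ≥0}
    (hu : 𝒜.motion x j u = x) :
    ∃ i, ∃ s ≤ u, 𝒜.trajectory i s = x := by
  have hcl : IsClosed {s | ∃ i, 𝒜.motion x i s = x} := by
    simp only [ofPred_exists]
    exact isClosed_iUnion_of_finite fun i ↦
      isClosed_eq (𝒜.isMotion_motion x hx i).2.continuous continuous_const
  obtain ⟨i, hi⟩ := hcl.csInf_mem ⟨u, j, hu⟩ (OrderBot.bddBelow _)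
  refine ⟨i, sInf {s | ∃ i, 𝒜.motion x i s = x}, csInf_le (OrderBot.bddBelow _) ?_, ?_⟩
  · exact ⟨j, hu⟩
  rw [← 𝒜.motion_eq_trajectory hx, hi]
  have hno (s) (hs : s < sInf {s | ∃ i, 𝒜.motion x i s = x}) (l : Fin 2) :
      ¬ HasReached (𝒜.motion x l) x s := by
    rintro ⟨v, hv, hvx⟩
    exact notMem_of_lt_csInf (hv.trans_lt hs) (OrderBot.bddBelow _) ⟨l, hvx⟩
  rintro s hs (h | ⟨v, hv, l, -, -, h⟩)
  · exact hno s hs i h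
  · exact hno v (hv.trans_lt hs) l h

/-- An agent that knows the exit is within reach of it, up to the range `r`, since the exit was
first visited. -/
theorem Algorithm.dist_le_of_knowsExit (hx : x ∈ perimeter) (hr : 0 ≤ r) {t : ℝ}
    (ht : UnvisitedBefore 𝒜.path x t) {i : Fin 2} {s : ℝ≥0} (hs : KnowsExit r (𝒜.motion x) x i s) :
    dist (𝒜.motion x i s) x ≤ s - t + r := by
  have hfind {j : Fin 2} {u : ℝ≥0} (hu : 𝒜.motion x j u = x) : t ≤ u := by
    obtain ⟨l, v, hv, hvx⟩ := 𝒜.exists_trajectory_eq hx hu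
    refine le_trans ?_ (NNReal.coe_le_coe.2 hv)
    by_contra! hc
    exact ht l v ⟨v.2, hc⟩ (by rw [Algorithm.path, Real.toNNReal_coe, hvx])
  rcases hs with ⟨u, hus, hux⟩ | ⟨v, hv, j, -, hd, u, huv, hux⟩
  · have := (𝒜.isMotion_motion x hx i).dist_le hus
    rw [hux] at this
    linarith [hfind hux]
  · have h1 := (𝒜.isMotion_motion x hx i).dist_le hv
    have h2 := (𝒜.isMotion_motion x hx j).dist_le huv
    rw [hux] at h2
    have := dist_triangle4 (𝒜.motion x i s) (𝒜.motion x i v) (𝒜.motion x j v) x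
    linarith [hfind hux]

theorem Algorithm.isSearch (hr : 0 ≤ r)
    (hT : ∀ x ∈ perimeter, ∀ i, HasReached (𝒜.motion x i) x T) :
    IsSearch vertexA vertexB vertexC 𝒜.path T r where
  lipschitz i := by
    have := (𝒜.isMotion_trajectory i).2.comp Real.lipschitzWith_toNNReal
    rwa [one_mul] at this
  start i := by
    rw [Algorithm.path, Real.toNNReal_zero, (𝒜.isMotion_trajectory i).1]
    rfl
  cover x hx := by
    obtain ⟨u, hu, hux⟩ := hT x hx 0
    obtain ⟨i, s, hs, hsx⟩ := 𝒜.exists_trajectory_eq hx hux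
    exact ⟨i, s, ⟨s.2, NNReal.coe_le_coe.2 (hs.trans hu)⟩,
      by rw [Algorithm.path, Real.toNNReal_coe, hsx]⟩
  dist_le x hx t ht i θ hθ := by
    lift θ to ℝ≥0 using hθ.1
    rw [Algorithm.path, Real.toNNReal_coe]
    by_cases hk : KnowsExit r (𝒜.motion x) x i θ
    · refine le_max_of_le_right (le_of_forall_pos_le_add fun ε hε ↦ ?_)
      -- `σ` is the time from which the agent knows the exit
      set σ := sInf {s | KnowsExit r (𝒜.motion x) x i s} with hσ
      have hσθ : σ ≤ θ := csInf_le (OrderBot.bddBelow _) hk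
      have hmot : 𝒜.motion x i σ = 𝒜.trajectory i σ :=
        𝒜.motion_eq_trajectory hx fun s hs hks ↦
          (csInf_le (OrderBot.bddBelow _) hks : σ ≤ s).not_gt hs
      obtain ⟨s, hks, hsε⟩ := exists_lt_of_csInf_lt ⟨θ, hk⟩
        (show sInf {s | KnowsExit r (𝒜.motion x) x i s} < σ + (ε / 2).toNNReal from
          lt_add_of_pos_right _ (Real.toNNReal_pos.2 (by positivity)))
      have hσs : σ ≤ s := csInf_le (OrderBot.bddBelow _) hks
      have hsε' : (s : ℝ) < σ + ε / 2 := by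
        have := NNReal.coe_lt_coe.2 hsε
        rwa [NNReal.coe_add, Real.coe_toNNReal _ (by positivity)] at this
      have h1 := (𝒜.isMotion_trajectory i).dist_le hσθ
      have h2 := (𝒜.isMotion_motion x hx i).dist_le hσs
      have h3 := 𝒜.dist_le_of_knowsExit hx hr ht hks
      rw [dist_comm, hmot] at h2
      have := dist_triangle4 (𝒜.trajectory i θ) (𝒜.trajectory i σ) (𝒜.motion x i s) x
      linarith
    · obtain ⟨u, hu, hux⟩ := hT x hx i
      have hθu : θ ≤ u := by
        by_contra! hc
        exact hk (Or.inl ⟨u, hc.le, hux⟩)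
      have h1 := (𝒜.isMotion_motion x hx i).dist_le hθu
      rw [hux, dist_comm, 𝒜.follows_trajectory x hx i θ hk] at h1
      refine le_max_of_le_left (h1.trans ?_)
      have := NNReal.coe_le_coe.2 hu
      linarith

end Algorithm

theorem isUnitTriangle : IsUnitTriangle vertexA vertexB vertexC :=
  ⟨side_lengths.1, side_lengths.2.1, side_lengths.2.2⟩

theorem Algorithm.le_evacuationTime {r : ℝ} (𝒜 : Algorithm r) (hr : 0 ≤ r) :
    ENNReal.ofReal (max (1.5 + y) (1 + 4 * y - r)) ≤ 𝒜.evacuationTime := by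
  by_contra! hlt
  obtain ⟨T, hT1, hT2⟩ := ENNReal.lt_iff_exists_nnreal_btwn.1 hlt
  have hT (x) (hx : x ∈ perimeter) (i) : HasReached (𝒜.motion x i) x T := by
    have h1 : 𝒜.evacuationTimeAt x < T :=
      (le_iSup₂ (f := fun x (_ : x ∈ perimeter) ↦ 𝒜.evacuationTimeAt x) x hx).trans_lt hT1
    obtain ⟨S, hS'⟩ := iInf_lt_iff.1 h1
    obtain ⟨hS, hST⟩ := iInf_lt_iff.1 hS'
    obtain ⟨s, hs, hsx⟩ := hS i
    exact ⟨s, hs.trans (ENNReal.coe_lt_coe.1 hST).le, hsx⟩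
  have hsearch := 𝒜.isSearch hr hT
  have h1 := hsearch.add_y_le isUnitTriangle
  have h2 := hsearch.add_four_mul_y_le isUnitTriangle hr
  refine hT2.not_ge ?_
  rw [← ENNReal.ofReal_coe_nnreal]
  exact ENNReal.ofReal_le_ofReal (max_le (by linarith) h2)

end TriangleEvacuation

theorem mainTheorem2 (r : ℝ) (hr0 : 0 ≤ r) (hr1 : r ≤ 1) :
    ENNReal.ofReal
        (max (1.5 + TriangleEvacuation.y) (1 + 4 * TriangleEvacuation.y - r)) ≤
      TriangleEvacuation.optimalEvacuationTime r :=
  le_iInf fun 𝒜 ↦ 𝒜.le_evacuationTime hr0
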